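/- **Setting.** A state $\omega$ is drawn from a probability measure $\mu$ on an arbitrary (possibly infinite) measurable space $\Omega$. There are $n\ge 1$ buyer types, $m\ge 1$ actions (the set $\mathcal A$), a type distribution $f\in\Delta[n]$, and measurable utilities $u^i(\cdot,a):\Omega\to[0,1]$ for $i\in[n]$, $a\in\mathcal A$. An experiment consists of a finite signal set $S$ and a measurable map $\omega\mapsto\pi(\cdot\mid\omega)\in\Delta S$. Put $$u^i=\max_{a\in\mathcal A}\mathbb E_{\omega\sim\mu}[u^i(\omega,a)],\qquad V(\pi,i)=\sum_{s\in S}\max_{a\in\mathcal A}\mathbb E_{\omega\sim\mu}[\pi(s\mid\omega)u^i(\omega,a)],$$ and, if $S=\mathcal A$, $\overline V(\pi,i)=\sum_{a\in\mathcal A}\mathbb E_{\omega\sim\mu}[\pi(a\mid\omega)u^i(\omega,a)]$. A menu is a set of experiments with real prices. Each type buys an item that maximizes $V(\text{item},i)-\text{price}$, or buys nothing (utility $u^i$, payment $0$) if that is optimal. The revenue is the $f$-average of the payments, and $R^*$ is the supremum of the revenue over all menus and all optimal choices of the types. A direct menu $\{E^i,t^i\}_{i\in[n]}$, where each $E^i$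 has signal set $\mathcal A$, is called incentive compatible if for all $i,j\in[n]$ $$\overline V(E^i,i)-t^i\ \ge\ V(E^j,i)-t^j,\qquad \overline V(E^i,i)-t^i\ \ge\ u^i$$ (for $i=j$ the first condition is obedience; if $t^i$ is random, it stands for its expectation here). **Algorithm** (sample budget $K\ge1$, reported type $i$, realized state $\overline\omega$). Put $\omega_1=\overline\omega$, draw $\omega_2,\dots,\omega_K\sim\mu$ independently, and find an optimal solution $\{\pi^i,t^i\}$ of the linear program $$\begin{aligned}\max\ &\textstyle\sum_{i} f_it^i\\ \text{s.t. }&\textstyle\sum_{a}\frac1K\sum_{k}\pi^i(a\mid\omega_k)u^i(\omega_k,a)-t^i\ \ge\ \sum_{a}v_{a,i,j}-t^j&&\forall i,j\in[n]\\ &\textstyle v_{a,i,j}\ \ge\ \frac1K\sum_{k}\pi^j(a\mid\omega_k)u^i(\omega_k,a')&&\forall a,a'\in\mathcal A,\ i,j\in[n]\\ &\textstyle\sum_{a}\frac1K\sum_{k}\pi^i(a\mid\omega_k)u^i(\omega_k,a)-t^i\ \ge\ u^i&&\forall i\in[n]\\ &\textstyle\pi^i(\cdot\mid\omega_k)\in\Delta\mathcal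 A&&\forall i\in[n],\ k\in[K]\end{aligned}$$ with the real variables $t^i$, $v_{a,i,j}$ and $\pi^i(a\mid\omega_k)$. Output a signal drawn from $\pi^i(\cdot\mid\overline\omega)$ and the price $t^i$. The solver is any (measurable, possibly randomized) map from $(\omega_1,\dots,\omega_K)$ to optimal solutions which respects the symmetry of the program: permuting $\omega_1,\dots,\omega_K$ does not change the distribution of $\pi^i(a\mid\omega)$ for any $i$, $a$ and any state $\omega$ in the list. **Theorem.** There is a universal constant $C>0$ such that for all $n,m\ge1$ and $\varepsilon,\delta\in(0,1)$ there is an integer $K\ge1$ with $$K\ \le\ \left\lceil C\,\min\left\{\frac{n^2}{\varepsilon^2},\frac1{\varepsilon^4}\right\}\,m\log\frac{mn}{\delta}\right\rceil,$$ depending only on $n,m,\varepsilon,\delta$, such that the following holds for every $\Omega,\mu,f,u$ and every solver as above. Let $E^i$ be the experiment that the algorithm executes for type $i$, i.e. $E^i(a\mid\overline\omega)=\mathbb E[\pi^i(a\mid\overline\omega)]$ over the samples $\omega_2,\dots,\omega_K$ and the solver, and let $t^i$ be its (random, integrable) price. Then $\{E^i,t^i\}$ is an incentive-compatible direct menu,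 and, with probability at least $1-\delta$ over $\overline\omega\sim\mu$, the samples and the solver, $$\sum_{i=1}^n f_it^i\ \ge\ R^*-\varepsilon .$$ -/

import Mathlib

open MeasureTheory ProbabilityTheory

namespace DataPricing

noncomputable section

/-! ### The model

`Ω` is the state space with common prior `μ`, types are `Fin n`, actions are `Fin m`, and
`u i ω a` is the utility of type `i` in state `ω` under action `a`. Definitions that concern a
single type take its utility `v : Ω → Fin m → ℝ` only. -/

/-- `π ω s` is the probability of the signal `s` in state `ω`, for a statistical experiment with
the finite signal set `S`. -/
structure IsExperiment {Ω S : Type*} [MeasurableSpace Ω] [Fintype S] (π : Ω → S → ℝ) : Prop where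
  measurable : ∀ s, Measurable fun ω => π ω s
  mem_simplex : ∀ ω, π ω ∈ stdSimplex ℝ S

/-- An experiment with some finite signal set. -/
structure Experiment (Ω : Type*) [MeasurableSpace Ω] where
  numSignals : ℕ
  prob : Ω → Fin numSignals → ℝ
  isExperiment : IsExperiment prob

/-- The utility of a buyer who buys nothing: `max_a E[v(ω, a)]`. -/
def baseline {Ω : Type*} [MeasurableSpace Ω] {m : ℕ} (μ : Measure Ω) (v : Ω → Fin m → ℝ) : ℝ :=
  ⨆ a, ∫ ω, v ω a ∂μ

/-- The value of an experiment for a buyer who best-responds to each signal: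
`V = ∑_s max_a E[π(s | ω) v(ω, a)]`. -/
def value {Ω S : Type*} [MeasurableSpace Ω] [Fintype S] {m : ℕ} (μ : Measure Ω)
    (v : Ω → Fin m → ℝ) (π : Ω → S → ℝ) : ℝ :=
  ∑ s, ⨆ a, ∫ ω, π ω s * v ω a ∂μ

/-- The utility of a buyer who takes the signal as the action:
`∑_a E[π(a | ω) v(ω, a)]`. -/
def obedientValue {Ω : Type*} [MeasurableSpace Ω] {m : ℕ} (μ : Measure Ω)
    (v : Ω → Fin m → ℝ) (π : Ω → Fin m → ℝ) : ℝ :=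
  ∑ a, ∫ ω, π ω a * v ω a ∂μ

/-- A menu: a set of experiments with their prices. The sign of prices is not restricted. -/
structure Menu (Ω : Type*) [MeasurableSpace Ω] where
  items : Set (Experiment Ω)
  price : items → ℝ

/-- What a buyer pays who buys the given item, or nothing (`none`). -/
def Menu.payment {Ω : Type*} [MeasurableSpace Ω] (M : Menu Ω) : Option M.items → ℝ
  | none => 0
  | some e => M.price e

/-- The expected net utility of a buyer who buys the given item, or nothing (`none`). -/
def Menu.netUtility {Ω : Type*} [MeasurableSpace Ω] {m : ℕ} (M : Menu Ω) (μ : Measure Ω)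
    (v : Ω → Fin m → ℝ) : Option M.items → ℝ
  | none => baseline μ v
  | some e => value μ v e.1.prob - M.price e

/-- The revenues `∑ i, f i * payment of type i` over all menus and all choices of the types that
maximize their net utility. -/
def achievableRevenues {Ω : Type*} [MeasurableSpace Ω] {n m : ℕ} (μ : Measure Ω)
    (f : Fin n → ℝ) (u : Fin n → Ω → Fin m → ℝ) : Set ℝ :=
  {R | ∃ (M : Menu Ω) (c : Fin n → Option M.items),
    (∀ i o, M.netUtility μ (u i) o ≤ M.netUtility μ (u i) (c i)) ∧
    R = ∑ i, f i * M.payment (c i)}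

/-- The optimal revenue `R*`. (The set contains `0`, through the empty menu, and it is bounded
above by `1` when utilities lie in `[0, 1]`.) -/
def optimalRevenue {Ω : Type*} [MeasurableSpace Ω] {n m : ℕ} (μ : Measure Ω)
    (f : Fin n → ℝ) (u : Fin n → Ω → Fin m → ℝ) : ℝ :=
  sSup (achievableRevenues μ f u)

/-- The direct menu that offers the experiment `E i`, with signals in the action set, at the price
`t i` to type `i` is responsive and incentive compatible (`ic`, which for `i = j` is obedience),
and individually rational (`ir`). -/
structure IsICDirectMenu {Ω : Type*} [MeasurableSpace Ω] {n m : ℕ} (μ : Measure Ω)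
    (u : Fin n → Ω → Fin m → ℝ) (E : Fin n → Ω → Fin m → ℝ) (t : Fin n → ℝ) : Prop where
  isExperiment : ∀ i, IsExperiment (E i)
  ic : ∀ i j, value μ (u i) (E j) - t j ≤ obedientValue μ (u i) (E i) - t i
  ir : ∀ i, baseline μ (u i) ≤ obedientValue μ (u i) (E i) - t i

/-! ### The linear program on `K` states -/

/-- The variables of the linear program: `x.1 i k a` is `πⁱ(a | ω_k)` and `x.2 i` is `tⁱ`. -/
abbrev LPPoint (n m K : ℕ) : Type := (Fin n → Fin K → Fin m → ℝ) × (Fin n → ℝ)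

/-- The constraints of the linear program for the states `ω 0, …, ω (K - 1)`; `w a i j` are its
auxiliary variables. -/
def IsLPFeasible {Ω : Type*} [MeasurableSpace Ω] {n m K : ℕ} (μ : Measure Ω)
    (u : Fin n → Ω → Fin m → ℝ) (ω : Fin K → Ω) (x : LPPoint n m K) : Prop :=
  (∀ i k, x.1 i k ∈ stdSimplex ℝ (Fin m)) ∧
  (∀ i, baseline μ (u i) ≤ (∑ a, (1 / (K : ℝ)) * ∑ k, x.1 i k a * u i (ω k) a) - x.2 i) ∧
  ∃ w : Fin m → Fin n → Fin n → ℝ,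
    (∀ a a' i j, (1 / (K : ℝ)) * ∑ k, x.1 j k a * u i (ω k) a' ≤ w a i j) ∧
    ∀ i j, (∑ a, w a i j) - x.2 j ≤ (∑ a, (1 / (K : ℝ)) * ∑ k, x.1 i k a * u i (ω k) a) - x.2 i

/-- `x` is an optimal solution of the linear program, whose objective is `∑ i, f i * tⁱ`. -/
def IsLPOptimal {Ω : Type*} [MeasurableSpace Ω] {n m K : ℕ} (μ : Measure Ω)
    (f : Fin n → ℝ) (u : Fin n → Ω → Fin m → ℝ) (ω : Fin K → Ω) (x : LPPoint n m K) : Prop :=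
  IsLPFeasible μ u ω x ∧
    ∀ y : LPPoint n m K, IsLPFeasible μ u ω y → ∑ i, f i * y.2 i ≤ ∑ i, f i * x.2 i

/-- A possibly randomized solver of the linear program: for each list of states `ω`, the output has
the law `κ ω` and is almost surely an optimal solution. It respects the symmetry of the program:
permuting the list does not change the law of `πⁱ(a | state)` for any state of the list. -/
structure IsSymmetricLPSolver {Ω : Type*} [MeasurableSpace Ω] {n m K : ℕ} (μ : Measure Ω)
    (f : Fin n → ℝ) (u : Fin n → Ω → Fin m → ℝ)
    (κ : Kernel (Fin K → Ω) (LPPoint n m K)) : Prop where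
  optimal : ∀ ω, ∀ᵐ x ∂(κ ω), IsLPOptimal μ f u ω x
  symmetric : ∀ (ω : Fin K → Ω) (σ : Equiv.Perm (Fin K)) (i : Fin n) (k : Fin K) (a : Fin m),
    (κ (ω ∘ σ)).map (fun x => x.1 i k a) = (κ ω).map (fun x => x.1 i (σ k) a)

/-! ### The algorithm with sample budget `K = N + 1` -/

theorem measurable_cons (Ω : Type*) [MeasurableSpace Ω] (N : ℕ) :
    Measurable fun p : Ω × (Fin N → Ω) => (Fin.cons p.1 p.2 : Fin (N + 1) → Ω) := by
  refine measurable_pi_iff.2 fun k => ?_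
  refine Fin.cases ?_ (fun j => ?_) k
  · simpa using measurable_fst
  · simpa [Function.comp_def] using (measurable_pi_apply j).comp measurable_snd

/-- Given the realized state, draw `N` independent samples from `μ`, put the realized state in
front of them (index `0`), and solve the linear program: the law of the solution. -/
def lpOutput {Ω : Type*} [MeasurableSpace Ω] {n m N : ℕ} (μ : Measure Ω)
    (κ : Kernel (Fin (N + 1) → Ω) (LPPoint n m (N + 1))) : Kernel Ω (LPPoint n m (N + 1)) :=
  (κ.comap (fun p : Ω × (Fin N → Ω) => (Fin.cons p.1 p.2 : Fin (N + 1) → Ω))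
    (measurable_cons Ω N)) ∘ₖ
    (Kernel.id ×ₖ Kernel.const Ω (Measure.pi fun _ : Fin N => μ))

/-- The law of the solution when the realized state is drawn from `μ`. -/
def lpOutputLaw {Ω : Type*} [MeasurableSpace Ω] {n m N : ℕ} (μ : Measure Ω)
    (κ : Kernel (Fin (N + 1) → Ω) (LPPoint n m (N + 1))) : Measure (LPPoint n m (N + 1)) :=
  μ.bind (lpOutput μ κ)

/-- The experiment executed for type `i`. In the realized state `ω` the algorithm solves the linear
program and outputs a signal drawn from `πⁱ(· | ω)`; so the signal is `a` with the probability
`E[πⁱ(a | ω)]`, over the samples and the solver. -/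
def algExperiment {Ω : Type*} [MeasurableSpace Ω] {n m N : ℕ} (μ : Measure Ω)
    (κ : Kernel (Fin (N + 1) → Ω) (LPPoint n m (N + 1))) (i : Fin n) (ω : Ω) (a : Fin m) : ℝ :=
  ∫ x, x.1 i 0 a ∂(lpOutput μ κ ω)

/-- The expectation of the random price `tⁱ` that the algorithm outputs for type `i`. -/
def algExpectedPrice {Ω : Type*} [MeasurableSpace Ω] {n m N : ℕ} (μ : Measure Ω)
    (κ : Kernel (Fin (N + 1) → Ω) (LPPoint n m (N + 1))) (i : Fin n) : ℝ :=
  ∫ x, x.2 i ∂(lpOutputLaw μ κ)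

end

end DataPricing

namespace DataPricing

noncomputable section

/-! Fix in advance how a buyer responds to signals, by a map `σ` from signals to actions. The payoff
`followValue` is then linear in the experiment, and `value` is its maximum over the finitely many
`σ`. Both halves of the theorem rest on this.

Incentives. The realized state and the fresh samples form one i.i.d. list. By symmetry of the solver
the realized state, at index 0, can be exchanged with any other entry, so for each fixed `σ` the
true payoff of the executed experiment is the expected payoff on the list
(`followValue_algExperiment`). The program enforces its constraints against every `σ` on every list.
A best response to the executed experiment is one fixed `σ`, so averaging the constraints gives
exact incentive compatibility, with no sampling error (`isICDirectMenu`).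

Revenue. The revelation principle gives a direct menu with revenue within `ε / 4` of the optimum. By
Hoeffding and a union bound over pairs of types and the `m ^ m` responses, its payoffs on the list
are, with high probability, accurate up to `e` in the directions needed. The restricted menu is then
only approximately incentive compatible. It is repaired by discounting prices and letting every type
take its favourite item with its best response (`exists_isLPFeasible_of_discount`). Since dearer
items get larger discounts, sampling noise cannot drive a type to a much cheaper item. Discounts
growing with the rank of the price lose `O(n e)`; discounts proportional to the price lose `O(η + e
/ η)`, which is `O(√e)` at the best `η`. These give the two terms of the minimum in the sample
bound. The solver's optimum is at least the revenue of the repaired menu. -/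

/-- The utility of a buyer who answers each signal `s` with the action `σ s`. -/
def followValue {Ω S : Type*} [MeasurableSpace Ω] [Fintype S] {m : ℕ} (μ : Measure Ω)
    (v : Ω → Fin m → ℝ) (π : Ω → S → ℝ) (σ : S → Fin m) : ℝ :=
  ∑ s, ∫ ω, π ω s * v ω (σ s) ∂μ

/-- The analogue of `followValue` for the uniform distribution on `Fin K`. -/
def empFollowValue {S : Type*} [Fintype S] {m K : ℕ}
    (v : Fin K → Fin m → ℝ) (π : Fin K → S → ℝ) (σ : S → Fin m) : ℝ :=
  ∑ s, (1 / (K : ℝ)) * ∑ k, π k s * v k (σ s)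

/-- The experiment whose signal is the image under `r` of the signal of `π`. -/
def relabel {Ω S : Type*} [Fintype S] {m : ℕ} (π : Ω → S → ℝ) (r : S → Fin m) :
    Ω → Fin m → ℝ :=
  fun ω b => ∑ s with r s = b, π ω s

/-! ### Relabelling signals by actions -/

theorem relabel_mem_stdSimplex {Ω S : Type*} [Fintype S] {m : ℕ} {π : Ω → S → ℝ} {ω : Ω}
    (h : π ω ∈ stdSimplex ℝ S) (r : S → Fin m) : relabel π r ω ∈ stdSimplex ℝ (Fin m) := by
  refine ⟨fun b => Finset.sum_nonneg fun s _ => h.1 s, ?_⟩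
  rw [← h.2]
  exact Finset.sum_fiberwise _ _ _

theorem exists_argmax {S : Type*} {m : ℕ} (hm : 0 < m) (F : S → Fin m → ℝ) :
    ∃ σ : S → Fin m, ∀ s a, F s a ≤ F s (σ s) := by
  have : Nonempty (Fin m) := ⟨⟨0, hm⟩⟩
  choose σ hσ using fun s => Finite.exists_max (F s)
  exact ⟨σ, hσ⟩

theorem sum_relabel {S : Type*} [Fintype S] {m : ℕ} (F : S → Fin m → ℝ) (r : S → Fin m)
    (σ : Fin m → Fin m) :
    ∑ b, ∑ s with r s = b, F s (σ b) = ∑ s, F s (σ (r s)) := by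
  rw [← Finset.sum_fiberwise (s := Finset.univ) (g := r)]
  refine Finset.sum_congr rfl fun b _ => Finset.sum_congr rfl fun s hs => ?_
  rw [(Finset.mem_filter.1 hs).2]

/-- Responding to a garbled signal amounts to a response to the original one, by composition. -/
theorem empFollowValue_relabel {S : Type*} [Fintype S] {m K : ℕ}
    (v : Fin K → Fin m → ℝ) (π : Fin K → S → ℝ) (r : S → Fin m) (σ : Fin m → Fin m) :
    empFollowValue v (relabel π r) σ = empFollowValue v π (σ ∘ r) := by
  unfold empFollowValue relabel
  simp only [Function.comp]
  rw [← sum_relabel (fun s a => (1 / (K : ℝ)) * ∑ k, π k s * v k a) r σ]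
  refine Finset.sum_congr rfl fun b _ => ?_
  rw [← Finset.mul_sum, Finset.sum_comm]
  simp only [Finset.sum_mul]

/-! ### Values as maxima over fixed responses -/

section Value

variable {Ω S : Type*} [MeasurableSpace Ω] [Fintype S] {m : ℕ} {μ : Measure Ω}
  {v : Ω → Fin m → ℝ} {π : Ω → S → ℝ}

theorem followValue_le_value (σ : S → Fin m) : followValue μ v π σ ≤ value μ v π :=
  Finset.sum_le_sum fun s _ =>
    le_ciSup (f := fun a => ∫ ω, π ω s * v ω a ∂μ) (Set.finite_range _).bddAbove (σ s)

/-- The maxima for different signals are independent, so the sum of maxima is attained by one map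
from signals to actions. -/
theorem exists_followValue_eq_value (hm : 0 < m) (μ : Measure Ω) (v : Ω → Fin m → ℝ)
    (π : Ω → S → ℝ) : ∃ σ : S → Fin m, followValue μ v π σ = value μ v π := by
  have : Nonempty (Fin m) := ⟨⟨0, hm⟩⟩
  obtain ⟨σ, hσ⟩ := exists_argmax hm fun s a => ∫ ω, π ω s * v ω a ∂μ
  refine ⟨σ, le_antisymm (followValue_le_value σ) ?_⟩
  exact Finset.sum_le_sum fun s _ => ciSup_le (hσ s)

theorem IsExperiment.mem_Icc (hπ : IsExperiment π) (ω : Ω) (s : S) :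
    π ω s ∈ Set.Icc (0 : ℝ) 1 :=
  ⟨(hπ.mem_simplex ω).1 s, stdSimplex.le_one ⟨π ω, hπ.mem_simplex ω⟩ s⟩

theorem integrable_of_mem_Icc [IsFiniteMeasure μ] {g : Ω → ℝ} (hg : Measurable g)
    (h : ∀ ω, g ω ∈ Set.Icc (0 : ℝ) 1) : Integrable g μ :=
  Integrable.of_bound hg.aestronglyMeasurable 1 <| .of_forall fun ω => by
    rw [Real.norm_eq_abs, abs_of_nonneg (h ω).1]; exact (h ω).2

theorem IsExperiment.integrable_mul [IsFiniteMeasure μ] (hπ : IsExperiment π)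
    (hv : ∀ a, Measurable fun ω => v ω a) (hv1 : ∀ ω a, v ω a ∈ Set.Icc (0 : ℝ) 1)
    (s : S) (a : Fin m) : Integrable (fun ω => π ω s * v ω a) μ :=
  integrable_of_mem_Icc ((hπ.measurable s).mul (hv a)) fun ω =>
    ⟨mul_nonneg (hπ.mem_Icc ω s).1 (hv1 ω a).1,
      mul_le_one₀ (hπ.mem_Icc ω s).2 (hv1 ω a).1 (hv1 ω a).2⟩

theorem IsExperiment.relabel (hπ : IsExperiment π) (r : S → Fin m) :
    IsExperiment (relabel π r) where
  measurable _ := Finset.measurable_fun_sum _ fun s _ => hπ.measurable s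
  mem_simplex ω := relabel_mem_stdSimplex (hπ.mem_simplex ω) r

theorem followValue_relabel [IsFiniteMeasure μ] (hπ : IsExperiment π)
    (hv : ∀ a, Measurable fun ω => v ω a) (hv1 : ∀ ω a, v ω a ∈ Set.Icc (0 : ℝ) 1)
    (r : S → Fin m) (σ : Fin m → Fin m) :
    followValue μ v (DataPricing.relabel π r) σ = followValue μ v π (σ ∘ r) := by
  unfold followValue DataPricing.relabel
  simp only [Function.comp]
  rw [← sum_relabel (fun s a => ∫ ω, π ω s * v ω a ∂μ) r σ]
  refine Finset.sum_congr rfl fun b _ => ?_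
  simp only [Finset.sum_mul]
  exact integral_finsetSum _ fun s _ => hπ.integrable_mul hv hv1 s _

theorem followValue_eq_integral [IsFiniteMeasure μ] (hπ : IsExperiment π)
    (hv : ∀ a, Measurable fun ω => v ω a) (hv1 : ∀ ω a, v ω a ∈ Set.Icc (0 : ℝ) 1)
    (σ : S → Fin m) :
    followValue μ v π σ = ∫ ω, ∑ s, π ω s * v ω (σ s) ∂μ :=
  (integral_finsetSum _ fun s _ => hπ.integrable_mul hv hv1 s _).symm

theorem sum_mul_mem_Icc {p : S → ℝ} (hp : p ∈ stdSimplex ℝ S) {g : S → ℝ}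
    (hg : ∀ s, g s ∈ Set.Icc (0 : ℝ) 1) : ∑ s, p s * g s ∈ Set.Icc (0 : ℝ) 1 := by
  refine ⟨Finset.sum_nonneg fun s _ => mul_nonneg (hp.1 s) (hg s).1, ?_⟩
  rw [← hp.2]
  exact Finset.sum_le_sum fun s _ => mul_le_of_le_one_right (hp.1 s) (hg s).2

theorem followValue_mem_Icc [IsProbabilityMeasure μ] (hπ : IsExperiment π)
    (hv : ∀ a, Measurable fun ω => v ω a) (hv1 : ∀ ω a, v ω a ∈ Set.Icc (0 : ℝ) 1)
    (σ : S → Fin m) : followValue μ v π σ ∈ Set.Icc (0 : ℝ) 1 := by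
  rw [followValue_eq_integral hπ hv hv1]
  have h := fun ω => sum_mul_mem_Icc (hπ.mem_simplex ω) fun s => hv1 ω (σ s)
  refine ⟨integral_nonneg fun ω => (h ω).1, ?_⟩
  calc _ ≤ ∫ _, (1 : ℝ) ∂μ := integral_mono_of_nonneg (.of_forall fun ω => (h ω).1)
        (integrable_const _) (.of_forall fun ω => (h ω).2)
    _ = 1 := by simp

theorem baseline_le_one [IsProbabilityMeasure μ] (hm : 0 < m)
    (hv1 : ∀ ω a, v ω a ∈ Set.Icc (0 : ℝ) 1) : baseline μ v ≤ 1 := by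
  have : Nonempty (Fin m) := ⟨⟨0, hm⟩⟩
  refine ciSup_le fun a => ?_
  calc _ ≤ ∫ _, (1 : ℝ) ∂μ := integral_mono_of_nonneg (.of_forall fun ω => (hv1 ω a).1)
        (integrable_const _) (.of_forall fun ω => (hv1 ω a).2)
    _ = 1 := by simp

end Value

theorem empFollowValue_mem_Icc {S : Type*} [Fintype S] {m K : ℕ}
    {v : Fin K → Fin m → ℝ} (hv1 : ∀ k a, v k a ∈ Set.Icc (0 : ℝ) 1) {π : Fin K → S → ℝ}
    (hπ : ∀ k, π k ∈ stdSimplex ℝ S) (σ : S → Fin m) :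
    empFollowValue v π σ ∈ Set.Icc (0 : ℝ) 1 := by
  have h := fun k => sum_mul_mem_Icc (hπ k) fun s => hv1 k (σ s)
  unfold empFollowValue
  rw [← Finset.mul_sum, Finset.sum_comm]
  refine ⟨mul_nonneg (by positivity) (Finset.sum_nonneg fun k _ => (h k).1), ?_⟩
  have h2 : ∑ k, ∑ s, π k s * v k (σ s) ≤ (K : ℝ) := by
    simpa using Finset.sum_le_sum fun k (_ : k ∈ Finset.univ) => (h k).2
  rcases Nat.eq_zero_or_pos K with rfl | hK
  · simp
  · have hK' : (0 : ℝ) < K := by exact_mod_cast hK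
    calc _ ≤ 1 / (K : ℝ) * K := by gcongr
      _ = 1 := by field_simp

/-! ### The revelation principle -/

section Revelation

variable {Ω : Type*} [MeasurableSpace Ω] {n m : ℕ} {μ : Measure Ω} [IsProbabilityMeasure μ]
  {u : Fin n → Ω → Fin m → ℝ}

/-- Garbling cannot help: a best response to the image signal pulls back to a feasible response to
the original. -/
theorem value_relabel_le {S : Type*} [Fintype S] (hm : 0 < m)
    {v : Ω → Fin m → ℝ} {π : Ω → S → ℝ} (hπ : IsExperiment π)
    (hv : ∀ a, Measurable fun ω => v ω a) (hv1 : ∀ ω a, v ω a ∈ Set.Icc (0 : ℝ) 1)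
    (r : S → Fin m) : value μ v (relabel π r) ≤ value μ v π := by
  obtain ⟨σ, hσ⟩ := exists_followValue_eq_value hm μ v (relabel π r)
  rw [← hσ, followValue_relabel hπ hv hv1]
  exact followValue_le_value _

theorem value_trivial (μ : Measure Ω) (v : Ω → Fin m → ℝ) : value μ v (fun _ (_ : Unit) => 1) = baseline μ v := by
  simp [value, baseline]

/-- The item bought by a type, as a direct experiment for this type. -/
theorem Menu.exists_direct_item (hm : 0 < m) (hu : ∀ i a, Measurable fun ω => u i ω a)
    (hu1 : ∀ i ω a, u i ω a ∈ Set.Icc (0 : ℝ) 1) (M : Menu Ω) (i : Fin n)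
    (o : Option M.items) :
    ∃ E : Ω → Fin m → ℝ, IsExperiment E ∧
      obedientValue μ (u i) E - M.payment o = M.netUtility μ (u i) o ∧
      ∀ j, value μ (u j) E - M.payment o ≤ M.netUtility μ (u j) o := by
  have key : ∀ {S : Type} [Fintype S] (π : Ω → S → ℝ), IsExperiment π →
      ∃ E : Ω → Fin m → ℝ, IsExperiment E ∧ obedientValue μ (u i) E = value μ (u i) π ∧
        ∀ j, value μ (u j) E ≤ value μ (u j) π := by
    intro S _ π hπ
    obtain ⟨r, hr⟩ := exists_followValue_eq_value hm μ (u i) π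
    refine ⟨relabel π r, hπ.relabel r, ?_, fun j => value_relabel_le hm hπ (hu j) (hu1 j) r⟩
    rw [← hr]
    exact followValue_relabel hπ (hu i) (hu1 i) r id
  cases o with
  | none =>
    -- Buying nothing is treated as an experiment with a single signal, at price 0.
    obtain ⟨E, hE, h1, h2⟩ := key (fun _ (_ : Unit) => 1)
      ⟨fun _ => measurable_const, fun _ => ⟨fun _ => zero_le_one, by simp⟩⟩
    refine ⟨E, hE, ?_, fun j => ?_⟩
    · simp [Menu.payment, Menu.netUtility, h1, value_trivial]
    · simpa [Menu.payment, Menu.netUtility, value_trivial] using h2 j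
  | some e =>
    obtain ⟨E, hE, h1, h2⟩ := key e.1.prob e.1.isExperiment
    refine ⟨E, hE, ?_, fun j => ?_⟩
    · simp [Menu.payment, Menu.netUtility, h1]
    · simpa [Menu.payment, Menu.netUtility] using h2 j

/-- The revelation principle. -/
theorem exists_isICDirectMenu (hm : 0 < m) (hu : ∀ i a, Measurable fun ω => u i ω a)
    (hu1 : ∀ i ω a, u i ω a ∈ Set.Icc (0 : ℝ) 1) {f : Fin n → ℝ} {R : ℝ}
    (hR : R ∈ achievableRevenues μ f u) :
    ∃ E t, IsICDirectMenu μ u E t ∧ ∑ i, f i * t i = R := by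
  obtain ⟨M, c, hc, rfl⟩ := hR
  choose E hE h1 h2 using fun i => M.exists_direct_item (μ := μ) hm hu hu1 i (c i)
  refine ⟨E, fun i => M.payment (c i), ⟨hE, fun i j => ?_, fun i => ?_⟩, rfl⟩
  · rw [h1]
    exact (h2 j i).trans (hc i (c j))
  · rw [h1]
    exact hc i none

theorem exists_isICDirectMenu_lt (hm : 0 < m) (hu : ∀ i a, Measurable fun ω => u i ω a)
    (hu1 : ∀ i ω a, u i ω a ∈ Set.Icc (0 : ℝ) 1) (f : Fin n → ℝ) {R : ℝ}
    (hR : R < optimalRevenue μ f u) :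
    ∃ E t, IsICDirectMenu μ u E t ∧ R < ∑ i, f i * t i := by
  have hne : (achievableRevenues μ f u).Nonempty := by
    refine ⟨_, ⟨∅, fun e => 0⟩, fun _ => none, ?_, rfl⟩
    rintro i (_ | ⟨e, he⟩)
    · exact le_rfl
    · exact absurd he (Set.notMem_empty e)
  obtain ⟨r, hr, hRr⟩ := exists_lt_of_lt_csSup hne hR
  obtain ⟨E, t, hE, rfl⟩ := exists_isICDirectMenu hm hu hu1 hr
  exact ⟨E, t, hE, hRr⟩

/-- With values in `[0, 1]`, a type charged over 1 more than another would gain by switching items.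
-/
theorem IsICDirectMenu.price_sub_le_one (hu : ∀ i a, Measurable fun ω => u i ω a)
    (hu1 : ∀ i ω a, u i ω a ∈ Set.Icc (0 : ℝ) 1) {E t} (h : IsICDirectMenu μ u E t)
    (i j : Fin n) : t i - t j ≤ 1 := by
  have h1 := h.ic i j
  have h2 : obedientValue μ (u i) (E i) ≤ 1 :=
    (followValue_mem_Icc (h.isExperiment i) (hu i) (hu1 i) id).2
  have h3 : 0 ≤ value μ (u i) (E j) :=
    (followValue_mem_Icc (h.isExperiment j) (hu i) (hu1 i) id).1.trans
      (followValue_le_value (σ := id))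
  linarith

end Revelation

/-! ### Feasibility and price bounds for the linear program -/

section LP

variable {Ω : Type*} [MeasurableSpace Ω] {n m K : ℕ} {μ : Measure Ω}
  {u : Fin n → Ω → Fin m → ℝ} {ω : Fin K → Ω} {x : LPPoint n m K}

/-- The auxiliary variables only encode maxima over actions: the least admissible ones are these
maxima, and their sum is the largest payoff over responses `σ`. -/
theorem isLPFeasible_iff (hm : 0 < m) : IsLPFeasible μ u ω x ↔
    (∀ i k, x.1 i k ∈ stdSimplex ℝ (Fin m)) ∧
    (∀ i, baseline μ (u i) ≤ empFollowValue (u i ∘ ω) (x.1 i) id - x.2 i) ∧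
    ∀ i j σ, empFollowValue (u i ∘ ω) (x.1 j) σ - x.2 j ≤
      empFollowValue (u i ∘ ω) (x.1 i) id - x.2 i := by
  refine and_congr_right fun _ => and_congr Iff.rfl ⟨?_, fun h => ?_⟩
  · rintro ⟨w, hw, h⟩ i j σ
    refine le_trans ?_ (h i j)
    gcongr
    exact Finset.sum_le_sum fun a _ => hw a (σ a) i j
  · choose σ hσ using fun i j => exists_argmax hm fun (a a' : Fin m) =>
      (1 / (K : ℝ)) * ∑ k, x.1 j k a * u i (ω k) a'
    exact ⟨fun a i j => (1 / (K : ℝ)) * ∑ k, x.1 j k a * u i (ω k) (σ i j a),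
      fun a a' i j => hσ i j a a', fun i j => h i j (σ i j)⟩

/-- The menu that tells every type its best action without looking at the state, at price `-1`. -/
theorem exists_isLPFeasible_neg_one [IsProbabilityMeasure μ] (hm : 0 < m)
    (hu1 : ∀ i ω a, u i ω a ∈ Set.Icc (0 : ℝ) 1) (ω : Fin K → Ω) :
    ∃ y : LPPoint n m K, IsLPFeasible μ u ω y ∧ ∀ i, y.2 i = -1 := by
  -- Here `r i` is the action that is best for type `i` on the list, which may differ from its best
  -- action under `μ`.
  choose r hr using fun i => exists_argmax hm fun (_ : Unit) (a : Fin m) =>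
    empFollowValue (u i ∘ ω) (fun _ (_ : Unit) => 1) fun _ => a
  have h1 : ∀ k : Fin K, (fun (_ : Fin K) (_ : Unit) => (1 : ℝ)) k ∈ stdSimplex ℝ Unit :=
    fun _ => ⟨fun _ => zero_le_one, by simp⟩
  refine ⟨(fun i => relabel (fun _ (_ : Unit) => 1) (r i), fun _ => -1),
    (isLPFeasible_iff hm).2 ⟨fun i k => ?_, fun i => ?_,
      fun i j σ => ?_⟩, fun _ => rfl⟩
  · exact relabel_mem_stdSimplex (π := fun (_ : Fin K) (_ : Unit) => 1) (ω := k) (h1 k) (r i)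
  · dsimp only
    rw [empFollowValue_relabel]
    -- The participation constraint uses the true baseline rather than the empirical one; the price
    -- `-1` makes up for any discrepancy, since the baseline is at most 1.
    have := (empFollowValue_mem_Icc (v := u i ∘ ω) (fun k => hu1 i (ω k)) h1 (id ∘ r i)).1
    linarith [baseline_le_one (μ := μ) hm (hu1 i)]
  · dsimp only
    rw [empFollowValue_relabel, empFollowValue_relabel]
    have := hr i () (σ (r j ()))
    gcongr
    exact this

/-- Participation caps prices at 1. From below, optimality compares with revenue `-1`, and the
incentive constraints keep prices within 1 of each other. These uniform bounds make the random price
integrable. -/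
theorem IsLPOptimal.price_mem_Icc [IsProbabilityMeasure μ] (hm : 0 < m)
    (hu1 : ∀ i ω a, u i ω a ∈ Set.Icc (0 : ℝ) 1) {f : Fin n → ℝ} (hf : f ∈ stdSimplex ℝ (Fin n))
    (hx : IsLPOptimal μ f u ω x) (i : Fin n) : x.2 i ∈ Set.Icc (-2 : ℝ) 1 := by
  obtain ⟨h1, h2, h3⟩ := (isLPFeasible_iff hm).1 hx.1
  have hI : ∀ i j σ, empFollowValue (u i ∘ ω) (x.1 j) σ ∈ Set.Icc (0 : ℝ) 1 :=
    fun i j => empFollowValue_mem_Icc (fun k => hu1 i (ω k)) (h1 j)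
  constructor
  · obtain ⟨y, hy, hy1⟩ := exists_isLPFeasible_neg_one (K := K) (μ := μ) hm hu1 ω
    have h4 := hx.2 y hy
    simp only [hy1, ← Finset.sum_mul, hf.2] at h4
    have h5 : ∑ j, f j * x.2 j ≤ ∑ j, f j * (x.2 i + 1) := by
      refine Finset.sum_le_sum fun j _ => mul_le_mul_of_nonneg_left ?_ (hf.1 j)
      linarith [h3 j i id, (hI j i id).1, (hI j j id).2]
    rw [← Finset.sum_mul, hf.2] at h5
    linarith
  · have h4 : 0 ≤ baseline μ (u i) := by
      have : Nonempty (Fin m) := ⟨⟨0, hm⟩⟩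
      exact Real.iSup_nonneg fun a => integral_nonneg fun ω => (hu1 i ω a).1
    linarith [h2 i, (hI i i id).2]

end LP

/-! ### Repairing approximate incentive compatibility by discounts -/

section Repair

variable {Ω : Type*} [MeasurableSpace Ω] {n m K : ℕ} {μ : Measure Ω} [IsProbabilityMeasure μ]
  {u : Fin n → Ω → Fin m → ℝ} {E : Fin n → Ω → Fin m → ℝ} {t : Fin n → ℝ} {f : Fin n → ℝ}
  {ω : Fin K → Ω} {e : ℝ}

/-- The lists of states on which the payoffs of a direct menu exceed their expectations by at
most `e`, and the payoffs of obedient buyers are at least their expectations minus `e`. -/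
def representativeSamples (K : ℕ) (μ : Measure Ω) (u E : Fin n → Ω → Fin m → ℝ) (e : ℝ) :
    Set (Fin K → Ω) :=
  {ω | (∀ i j σ, empFollowValue (u i ∘ ω) (E j ∘ ω) σ ≤ followValue μ (u i) (E j) σ + e) ∧
    ∀ i, obedientValue μ (u i) (E i) ≤ empFollowValue (u i ∘ ω) (E i ∘ ω) id + e}

omit [IsProbabilityMeasure μ] in
/-- On a representative sample, discounts `d` make an incentive-compatible menu feasible for the
linear program, when every type is given its favourite discounted item. If much cheaper items
have smaller discounts, the loss of revenue is small. -/
theorem exists_isLPFeasible_of_discount (hm : 0 < m) (hf : f ∈ stdSimplex ℝ (Fin n))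
    (hE : IsICDirectMenu μ u E t) (hω : ω ∈ representativeSamples K μ u E e)
    {d : Fin n → ℝ} {L : ℝ} (hde : ∀ i, e ≤ d i)
    (hd : ∀ i j, t j - d j < t i - L → 2 * e < d i - d j) :
    ∃ y : LPPoint n m K, IsLPFeasible μ u ω y ∧ ∑ i, f i * t i - L ≤ ∑ i, f i * y.2 i := by
  obtain ⟨hup, hlow⟩ := hω
  have : Nonempty (Fin m) := ⟨⟨0, hm⟩⟩
  -- Every type optimizes over items and responses jointly. A deviation to another type's relabelled
  -- item is again such a pair, so the incentive constraints then hold exactly.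
  have hbest : ∀ i : Fin n, ∃ p : Fin n × (Fin m → Fin m), ∀ q : Fin n × (Fin m → Fin m),
      empFollowValue (u i ∘ ω) (E q.1 ∘ ω) q.2 - (t q.1 - d q.1) ≤
        empFollowValue (u i ∘ ω) (E p.1 ∘ ω) p.2 - (t p.1 - d p.1) := fun i => by
    have : Nonempty (Fin n) := ⟨i⟩
    exact Finite.exists_max _
  choose p hp using hbest
  refine ⟨(fun i => relabel (E (p i).1 ∘ ω) (p i).2, fun i => t (p i).1 - d (p i).1),
    (isLPFeasible_iff hm).2 ⟨fun i k => ?_, fun i => ?_, fun i j σ => ?_⟩, ?_⟩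
  · exact relabel_mem_stdSimplex (π := E (p i).1 ∘ ω)
      ((hE.isExperiment (p i).1).mem_simplex (ω k)) (p i).2
  · dsimp only
    rw [empFollowValue_relabel]
    have h1 := hp i (i, id)
    dsimp only at h1
    rw [Function.id_comp]
    -- The discount of at least `e` offsets the loss of the obedient payoff on the sample.
    linarith [hE.ir i, hlow i, hde i]
  · dsimp only
    rw [empFollowValue_relabel, empFollowValue_relabel, Function.id_comp]
    exact hp i ((p j).1, σ ∘ (p j).2)
  · have h : ∀ i, t i - L ≤ t (p i).1 - d (p i).1 := by
      intro i
      by_contra! hlt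
      have h1 := hd i _ hlt
      have h2 := hp i (i, id)
      dsimp only at h2
      have h3 := hup i (p i).1 (p i).2
      have h4 := followValue_le_value (μ := μ) (v := u i) (π := E (p i).1) (p i).2
      -- Preferring the cheaper item on the sample although the true payoffs satisfy `ic` needs an
      -- advantage from two sampling errors, `2 * e`, to outweigh the discount difference.
      linarith [hE.ic i (p i).1, hlow i]
    calc ∑ i, f i * t i - L = ∑ i, f i * (t i - L) := by
          simp only [mul_sub, Finset.sum_sub_distrib, ← Finset.sum_mul, hf.2, one_mul]
      _ ≤ _ := Finset.sum_le_sum fun i _ => mul_le_mul_of_nonneg_left (h i) (hf.1 i)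

omit [IsProbabilityMeasure μ] in
/-- Discounts that increase with the rank of the price. -/
theorem exists_isLPFeasible_of_rank_discount (hm : 0 < m) (hf : f ∈ stdSimplex ℝ (Fin n))
    (he : 0 < e) (hE : IsICDirectMenu μ u E t) (hω : ω ∈ representativeSamples K μ u E e) :
    ∃ y : LPPoint n m K, IsLPFeasible μ u ω y ∧
      ∑ i, f i * t i - (1 + 3 * n) * e ≤ ∑ i, f i * y.2 i := by
  have hle : ∀ i, ((Finset.univ.filter fun k => t k < t i).card : ℝ) ≤ n := fun i => by
    exact_mod_cast (Finset.card_le_univ _).trans_eq (Fintype.card_fin n)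
  refine exists_isLPFeasible_of_discount hm hf hE hω
    -- A strictly higher price has a strictly larger rank, hence a discount larger by at least `3 *
    -- e`, strictly above the required `2 * e`. Ranks are at most `n`, whence the loss `(1 + 3 * n)
    -- * e`.
    (d := fun i => e + 3 * e * (Finset.univ.filter fun k => t k < t i).card)
    (fun i => le_add_of_nonneg_right (by positivity)) fun i j hij => ?_
  have h1 := mul_le_mul_of_nonneg_left (hle j) he.le
  have hlt : t j < t i := by nlinarith
  have hcard : (Finset.univ.filter fun k => t k < t j).card <
      (Finset.univ.filter fun k => t k < t i).card := by
    refine Finset.card_lt_card ((Finset.ssubset_iff_of_subset fun k hk => ?_).2 ⟨j, ?_, ?_⟩)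
    · simp only [Finset.mem_filter, Finset.mem_univ, true_and] at hk ⊢
      exact hk.trans hlt
    · simpa using hlt
    · simp
  have hcard' : ((Finset.univ.filter fun k => t k < t j).card : ℝ) + 1 ≤
      (Finset.univ.filter fun k => t k < t i).card := by exact_mod_cast hcard
  have := mul_le_mul_of_nonneg_left hcard' he.le
  linarith

/-- Discounts that are proportional to the price. -/
theorem exists_isLPFeasible_of_proportional_discount (hm : 0 < m) (hf : f ∈ stdSimplex ℝ (Fin n))
    (hu : ∀ i a, Measurable fun ω => u i ω a) (hu1 : ∀ i ω a, u i ω a ∈ Set.Icc (0 : ℝ) 1)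
    (he : 0 < e) {η : ℝ} (hη : 0 < η) (hE : IsICDirectMenu μ u E t)
    (hω : ω ∈ representativeSamples K μ u E e) :
    ∃ y : LPPoint n m K, IsLPFeasible μ u ω y ∧
      ∑ i, f i * t i - (η + e + 3 * e / η) ≤ ∑ i, f i * y.2 i := by
  have : Nonempty (Fin n) := by
    by_contra h
    rw [not_nonempty_iff] at h
    simpa using hf.2
  obtain ⟨i₀, h0⟩ := Finite.exists_min t
  refine exists_isLPFeasible_of_discount hm hf hE hω (d := fun i => e + η * (t i - t i₀))
    -- In the loss, `η + e` bounds every discount because prices differ by at most 1, and `3 * e /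
    -- η` is the price gap at which discounts differ by `3 * e`.
    (fun i => le_add_of_nonneg_right (mul_nonneg hη.le (sub_nonneg.2 (h0 i)))) fun i j hij => ?_
  have h1 : η * (t j - t i₀) ≤ η * 1 :=
    mul_le_mul_of_nonneg_left (hE.price_sub_le_one hu hu1 j i₀) hη.le
  have h2 : 3 * e / η < t i - t j := by linarith
  rw [div_lt_iff₀ hη] at h2
  linarith

end Repair

/-! ### Concentration of payoffs on an i.i.d. list -/

section Concentration

variable {Ω : Type*} [MeasurableSpace Ω] {n m K : ℕ} {μ : Measure Ω} [IsProbabilityMeasure μ]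

/-- The upper tail in Hoeffding's inequality for the mean of an i.i.d. sample. -/
theorem measureReal_integral_add_lt_mean_le (hK : 0 < K) {h : Ω → ℝ} (hh : Measurable h)
    (h1 : ∀ ω, h ω ∈ Set.Icc (0 : ℝ) 1) {e : ℝ} (he : 0 ≤ e) :
    (Measure.pi fun _ : Fin K => μ).real
      {ω | ∫ x, h x ∂μ + e < (1 / (K : ℝ)) * ∑ k, h (ω k)} ≤ Real.exp (-2 * K * e ^ 2) := by
  have hK' : (0 : ℝ) < K := by exact_mod_cast hK
  -- Hoeffding's lemma: a centred variable with values in an interval of length 1 has variance proxy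
  -- `1 / 4`.
  have hsub : HasSubgaussianMGF (fun x => h x - ∫ y, h y ∂μ) ((‖(1 : ℝ) - 0‖₊ / 2) ^ 2) μ :=
    hasSubgaussianMGF_of_mem_Icc hh.aemeasurable (.of_forall h1)
  have hind : iIndepFun (fun (k : Fin K) ω => h (ω k) - ∫ y, h y ∂μ)
      (Measure.pi fun _ : Fin K => μ) :=
    iIndepFun_pi (X := fun _ x => h x - ∫ y, h y ∂μ)
      fun _ => (hh.sub_const _).aemeasurable
  have hsub' : ∀ k ∈ (Finset.univ : Finset (Fin K)),
      HasSubgaussianMGF (fun ω : Fin K → Ω => h (ω k) - ∫ y, h y ∂μ)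
        ((‖(1 : ℝ) - 0‖₊ / 2) ^ 2) (Measure.pi fun _ : Fin K => μ) := by
    intro k _
    have hmp := measurePreserving_eval (fun _ : Fin K => μ) k
    refine HasSubgaussianMGF.of_map (Y := fun ω : Fin K → Ω => ω k)
      (X := fun x => h x - ∫ y, h y ∂μ) hmp.measurable.aemeasurable ?_
    have h2 : (Measure.pi fun _ : Fin K => μ).map (fun ω => ω k) = μ := hmp.map_eq
    rwa [h2]
  have hH := HasSubgaussianMGF.measure_sum_ge_le_of_iIndepFun hind hsub'
    (mul_nonneg hK'.le he)
  refine (measureReal_mono fun ω hω => ?_).trans (hH.trans_eq ?_)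
  · simp only [Set.mem_ofPred_eq, Finset.sum_sub_distrib, Finset.sum_const, Finset.card_univ,
      Fintype.card_fin, nsmul_eq_mul] at hω ⊢
    have := mul_le_mul_of_nonneg_left hω.le hK'.le
    rw [← mul_assoc, mul_one_div_cancel hK'.ne', one_mul] at this
    linarith
  · congr 1
    simp
    field_simp

/-- The lower tail in Hoeffding's inequality for the mean of an i.i.d. sample. -/
theorem measureReal_mean_add_lt_integral_le (hK : 0 < K) {h : Ω → ℝ} (hh : Measurable h)
    (h1 : ∀ ω, h ω ∈ Set.Icc (0 : ℝ) 1) {e : ℝ} (he : 0 ≤ e) :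
    (Measure.pi fun _ : Fin K => μ).real
      {ω | (1 / (K : ℝ)) * ∑ k, h (ω k) + e < ∫ x, h x ∂μ} ≤ Real.exp (-2 * K * e ^ 2) := by
  have hK' : (K : ℝ) ≠ 0 := by exact_mod_cast hK.ne'
  refine (measureReal_mono fun ω hω => ?_).trans <| measureReal_integral_add_lt_mean_le hK
    (h := fun x => 1 - h x) (measurable_const.sub hh)
    (fun x => ⟨sub_nonneg.2 (h1 x).2, sub_le_self _ (h1 x).1⟩) he
  have h3 : ∫ x, (1 - h x) ∂μ = 1 - ∫ x, h x ∂μ := by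
    rw [integral_sub (integrable_const _) (integrable_of_mem_Icc hh h1)]
    simp
  simp only [Set.mem_ofPred_eq, h3, Finset.sum_sub_distrib, Finset.sum_const, Finset.card_univ,
      Fintype.card_fin, nsmul_eq_mul, mul_sub, mul_one, one_div_mul_cancel hK'] at hω ⊢
  linarith

omit [MeasurableSpace Ω] in
theorem empFollowValue_eq_mean {S : Type*} [Fintype S] (v : Ω → Fin m → ℝ) (π : Ω → S → ℝ)
    (σ : S → Fin m) (ω : Fin K → Ω) :
    empFollowValue (v ∘ ω) (π ∘ ω) σ =
      (1 / (K : ℝ)) * ∑ k, ∑ s, π (ω k) s * v (ω k) (σ s) := by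
  unfold empFollowValue
  rw [← Finset.mul_sum, Finset.sum_comm]
  rfl

variable {u : Fin n → Ω → Fin m → ℝ} {E : Fin n → Ω → Fin m → ℝ}

variable (hu : ∀ i a, Measurable fun ω => u i ω a) (hu1 : ∀ i ω a, u i ω a ∈ Set.Icc (0 : ℝ) 1)
  (hE : ∀ i, IsExperiment (E i)) {e : ℝ}

include hu hE in
theorem measurable_sum_mul (i j : Fin n) (σ : Fin m → Fin m) :
    Measurable fun ω => ∑ s, E j ω s * u i ω (σ s) :=
  Finset.measurable_fun_sum _ fun s _ => ((hE j).measurable s).mul (hu i _)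

include hu hu1 hE in
theorem measureReal_follow_upper (hK : 0 < K) (he : 0 ≤ e) (i j : Fin n) (σ : Fin m → Fin m) :
    (Measure.pi fun _ : Fin K => μ).real
      {ω | followValue μ (u i) (E j) σ + e < empFollowValue (u i ∘ ω) (E j ∘ ω) σ} ≤
      Real.exp (-2 * K * e ^ 2) := by
  simp only [empFollowValue_eq_mean, followValue_eq_integral (hE j) (hu i) (hu1 i)]
  exact measureReal_integral_add_lt_mean_le hK (measurable_sum_mul hu hE i j σ)
    (fun ω => sum_mul_mem_Icc ((hE j).mem_simplex ω) fun s => hu1 i ω (σ s)) he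

include hu hu1 hE in
theorem measureReal_obedient_lower (hK : 0 < K) (he : 0 ≤ e) (i : Fin n) :
    (Measure.pi fun _ : Fin K => μ).real
      {ω | empFollowValue (u i ∘ ω) (E i ∘ ω) id + e < obedientValue μ (u i) (E i)} ≤
      Real.exp (-2 * K * e ^ 2) := by
  have h : obedientValue μ (u i) (E i) = _ := followValue_eq_integral (hE i) (hu i) (hu1 i) id
  simp only [empFollowValue_eq_mean, h]
  exact measureReal_mean_add_lt_integral_le hK (measurable_sum_mul hu hE i i id)
    (fun ω => sum_mul_mem_Icc ((hE i).mem_simplex ω) fun s => hu1 i ω s) he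

-- A union bound: `n ^ 2 * m ^ m` upper-tail events, one for each pair of types and response, and
-- `n` lower-tail events for obedience.
include hu hu1 hE in
theorem measureReal_representativeSamples_compl_le (hK : 0 < K) (he : 0 ≤ e) :
    (Measure.pi fun _ : Fin K => μ).real (representativeSamples K μ u E e)ᶜ ≤
      ((n : ℝ) ^ 2 * (m : ℝ) ^ m + n) * Real.exp (-2 * K * e ^ 2) := by
  have hsub : (representativeSamples K μ u E e)ᶜ ⊆
      (⋃ p : Fin n × Fin n × (Fin m → Fin m), {ω | followValue μ (u p.1) (E p.2.1) p.2.2 + e <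
        empFollowValue (u p.1 ∘ ω) (E p.2.1 ∘ ω) p.2.2}) ∪
      ⋃ i, {ω | empFollowValue (u i ∘ ω) (E i ∘ ω) id + e < obedientValue μ (u i) (E i)} := by
    intro ω hω
    rw [representativeSamples, Set.mem_compl_iff, Set.mem_ofPred_eq, not_and_or] at hω
    push Not at hω
    rcases hω with ⟨i, j, σ, h⟩ | ⟨i, h⟩
    · exact .inl (Set.mem_iUnion.2 ⟨(i, j, σ), h⟩)
    · exact .inr (Set.mem_iUnion.2 ⟨i, h⟩)
  refine (measureReal_mono hsub).trans <| (measureReal_union_le _ _).trans ?_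
  rw [add_mul]
  refine add_le_add ((measureReal_iUnion_fintype_le _).trans ?_)
    ((measureReal_iUnion_fintype_le _).trans ?_)
  · refine (Finset.sum_le_sum fun p _ =>
      measureReal_follow_upper hu hu1 hE hK he p.1 p.2.1 p.2.2).trans_eq ?_
    simp [pow_two, mul_assoc]
  · refine (Finset.sum_le_sum fun i _ =>
      measureReal_obedient_lower hu hu1 hE hK he i).trans_eq ?_
    simp

end Concentration

/-! ### The law of the algorithm's output -/

section Output

variable {Ω : Type*} [MeasurableSpace Ω] {n m N : ℕ} {μ : Measure Ω} [IsProbabilityMeasure μ]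
  {κ : Kernel (Fin (N + 1) → Ω) (LPPoint n m (N + 1))} [IsMarkovKernel κ]

theorem measurePreserving_cons (μ : Measure Ω) [SigmaFinite μ] (N : ℕ) :
    MeasurePreserving (fun p : Ω × (Fin N → Ω) => (Fin.cons p.1 p.2 : Fin (N + 1) → Ω))
      (μ.prod (Measure.pi fun _ : Fin N => μ)) (Measure.pi fun _ : Fin (N + 1) => μ) := by
  convert! (measurePreserving_piFinSuccAbove (fun _ : Fin (N + 1) => μ) 0).symm using 1
  funext p
  simp [MeasurableEquiv.piFinSuccAbove, Fin.insertNthEquiv]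

theorem measurePreserving_comp_perm {ι : Type*} [Fintype ι] (μ : Measure Ω) [SigmaFinite μ]
    (σ : Equiv.Perm ι) :
    MeasurePreserving (fun ω : ι → Ω => ω ∘ σ) (Measure.pi fun _ => μ)
      (Measure.pi fun _ => μ) := by
  convert! measurePreserving_arrowCongr' (fun _ : ι => μ) (fun _ : ι => μ) σ.symm
    (MeasurableEquiv.refl Ω) fun _ => MeasurePreserving.id μ using 1

omit [IsMarkovKernel κ] in
theorem lpOutput_apply (ω : Ω) :
    lpOutput μ κ ω =
      ((Measure.pi fun _ : Fin N => μ).map fun z => (Fin.cons ω z : Fin (N + 1) → Ω)).bind κ := by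
  have hc := measurable_cons Ω N
  rw [lpOutput, ← Kernel.comp_deterministic_eq_comap κ hc, Kernel.comp_assoc, Kernel.comp_apply,
    Kernel.comp_apply, Measure.deterministic_comp_eq_map, Kernel.prod_apply, Kernel.id_apply,
    Kernel.const_apply, Measure.dirac_prod, Measure.map_map hc measurable_prodMk_left]
  rfl

-- A realized state drawn from `μ`, put in front of `N` independent samples, is an i.i.d. list of
-- length `N + 1`.
omit [IsMarkovKernel κ] in
theorem lpOutputLaw_eq : lpOutputLaw μ κ = (Measure.pi fun _ : Fin (N + 1) => μ).bind κ := by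
  have hc := measurable_cons Ω N
  rw [lpOutputLaw, lpOutput, ← Measure.comp_assoc, ← Measure.compProd_eq_comp_prod,
    Measure.compProd_const, ← Kernel.comp_deterministic_eq_comap κ hc, ← Measure.comp_assoc,
    Measure.deterministic_comp_eq_map, (measurePreserving_cons μ N).map_eq]

instance : IsProbabilityMeasure (lpOutputLaw μ κ) := by
  rw [lpOutputLaw_eq]; infer_instance

instance : IsMarkovKernel (lpOutput μ κ) := by
  unfold lpOutput
  infer_instance

end Output

theorem integral_bind_of_mem_Icc {α β : Type*} [MeasurableSpace α] [MeasurableSpace β]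
    {ν : Measure α} [IsProbabilityMeasure ν] {κ : Kernel α β} [IsMarkovKernel κ] {F : β → ℝ}
    (hF : Measurable F) {b c : ℝ} (h : ∀ z, ∀ᵐ x ∂κ z, F x ∈ Set.Icc b c) :
    Integrable F (ν.bind κ) ∧ ∫ x, F x ∂(ν.bind κ) = ∫ z, ∫ x, F x ∂κ z ∂ν := by
  have h1 : ∀ᵐ x ∂(ν.bind κ), F x ∈ Set.Icc b c :=
    Measure.ae_comp_of_ae_ae (hF measurableSet_Icc) (.of_forall h)
  have h2 : Integrable F (ν.bind κ) := Integrable.of_mem_Icc b c hF.aemeasurable h1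
  refine ⟨h2, ?_⟩
  rw [Measure.comp_eq_comp_const_apply] at h2 ⊢
  rw [Kernel.integral_comp h2]
  simp

theorem integral_mem_Icc {α : Type*} [MeasurableSpace α] {ν : Measure α} [IsProbabilityMeasure ν]
    {F : α → ℝ} (hF : Measurable F) {b c : ℝ} (h : ∀ᵐ x ∂ν, F x ∈ Set.Icc b c) :
    ∫ x, F x ∂ν ∈ Set.Icc b c :=
  (convex_Icc b c).integral_mem isClosed_Icc h (Integrable.of_mem_Icc b c hF.aemeasurable h)

/-! ### Incentive compatibility by exchangeability, and revenue of the solver -/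

section Incentives

variable {Ω : Type*} [MeasurableSpace Ω] {n m N : ℕ} {μ : Measure Ω} [IsProbabilityMeasure μ]
  {κ : Kernel (Fin (N + 1) → Ω) (LPPoint n m (N + 1))} [IsMarkovKernel κ]
  {f : Fin n → ℝ} {u : Fin n → Ω → Fin m → ℝ}

theorem measurable_signal {K : ℕ} (i : Fin n) (k : Fin K) (a : Fin m) :
    Measurable fun x : LPPoint n m K => x.1 i k a := by fun_prop

theorem measurable_price {K : ℕ} (i : Fin n) : Measurable fun x : LPPoint n m K => x.2 i := by
  fun_prop

/-- The probability of the signal `a` in the state number `k` of the list `z`, for a randomized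
solver. -/
def expectedSignal {K : ℕ} (κ : Kernel (Fin K → Ω) (LPPoint n m K)) (i : Fin n) (z : Fin K → Ω)
    (k : Fin K) (a : Fin m) : ℝ :=
  ∫ x, x.1 i k a ∂κ z

theorem measurable_expectedSignal {K : ℕ} (κ : Kernel (Fin K → Ω) (LPPoint n m K))
    [IsMarkovKernel κ] (i : Fin n) (k : Fin K) (a : Fin m) :
    Measurable fun z => expectedSignal κ i z k a :=
  ((measurable_signal i k a).stronglyMeasurable.integral_kernel (κ := κ)).measurable

variable (hκ : IsSymmetricLPSolver μ f u κ)

include hκ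

omit [IsProbabilityMeasure μ] [IsMarkovKernel κ] in
theorem IsSymmetricLPSolver.ae_mem_stdSimplex (i : Fin n) (k : Fin (N + 1))
    (z : Fin (N + 1) → Ω) : ∀ᵐ x ∂κ z, x.1 i k ∈ stdSimplex ℝ (Fin m) := by
  filter_upwards [hκ.optimal z] with x hx using hx.1.1 i k

omit [IsProbabilityMeasure μ] [IsMarkovKernel κ] in
theorem IsSymmetricLPSolver.ae_signal_mem_Icc (i : Fin n) (k : Fin (N + 1)) (a : Fin m)
    (z : Fin (N + 1) → Ω) : ∀ᵐ x ∂κ z, x.1 i k a ∈ Set.Icc (0 : ℝ) 1 := by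
  filter_upwards [hκ.ae_mem_stdSimplex i k z] with x hx using ⟨hx.1 a, stdSimplex.le_one ⟨_, hx⟩ a⟩

omit [IsProbabilityMeasure μ] in
theorem IsSymmetricLPSolver.integrable_signal (i : Fin n) (k : Fin (N + 1)) (a : Fin m)
    (z : Fin (N + 1) → Ω) : Integrable (fun x => x.1 i k a) (κ z) :=
  Integrable.of_mem_Icc 0 1 (measurable_signal i k a).aemeasurable (hκ.ae_signal_mem_Icc i k a z)

omit [IsProbabilityMeasure μ] in
theorem IsSymmetricLPSolver.expectedSignal_mem_Icc (i : Fin n) (z : Fin (N + 1) → Ω)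
    (k : Fin (N + 1)) (a : Fin m) : expectedSignal κ i z k a ∈ Set.Icc (0 : ℝ) 1 :=
  integral_mem_Icc (measurable_signal i k a) (hκ.ae_signal_mem_Icc i k a z)

-- Payoffs are linear in the signal probabilities, so the symmetry of each marginal law is used only
-- through its mean.
omit [IsProbabilityMeasure μ] [IsMarkovKernel κ] in
theorem IsSymmetricLPSolver.expectedSignal_comp_perm (i : Fin n) (z : Fin (N + 1) → Ω)
    (σ : Equiv.Perm (Fin (N + 1))) (k : Fin (N + 1)) (a : Fin m) :
    expectedSignal κ i (z ∘ σ) k a = expectedSignal κ i z (σ k) a := by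
  have h := congrArg (fun ν => ∫ y, y ∂ν) (hκ.symmetric z σ i k a)
  rwa [integral_map (measurable_signal i k a).aemeasurable (by fun_prop),
    integral_map (measurable_signal i (σ k) a).aemeasurable (by fun_prop)] at h

theorem IsSymmetricLPSolver.algExperiment_eq (i : Fin n) (ω : Ω) (a : Fin m) :
    algExperiment μ κ i ω a =
      ∫ z, expectedSignal κ i (Fin.cons ω z) 0 a ∂(Measure.pi fun _ : Fin N => μ) := by
  have hc : Measurable fun z : Fin N → Ω => (Fin.cons ω z : Fin (N + 1) → Ω) :=
    (measurable_cons Ω N).comp measurable_prodMk_left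
  have : IsProbabilityMeasure
      ((Measure.pi fun _ : Fin N => μ).map fun z => (Fin.cons ω z : Fin (N + 1) → Ω)) :=
    Measure.isProbabilityMeasure_map hc.aemeasurable
  rw [algExperiment, lpOutput_apply, (integral_bind_of_mem_Icc (measurable_signal i 0 a)
    (hκ.ae_signal_mem_Icc i 0 a)).2,
    integral_map hc.aemeasurable]
  · rfl
  · exact (measurable_expectedSignal κ i 0 a).aestronglyMeasurable

theorem IsSymmetricLPSolver.isExperiment_algExperiment (i : Fin n) :
    IsExperiment (algExperiment μ κ i) where
  measurable a :=
    ((measurable_signal i 0 a).stronglyMeasurable.integral_kernel (κ := lpOutput μ κ)).measurable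
  mem_simplex ω := by
    have hae : ∀ᵐ x ∂lpOutput μ κ ω, x.1 i 0 ∈ stdSimplex ℝ (Fin m) := by
      rw [lpOutput_apply]
      refine Measure.ae_comp_of_ae_ae ?_ (.of_forall fun z => hκ.ae_mem_stdSimplex i 0 z)
      exact (by fun_prop : Measurable fun x : LPPoint n m (N + 1) => x.1 i 0)
        (isClosed_stdSimplex ℝ (Fin m)).measurableSet
    refine ⟨fun a => integral_nonneg_of_ae ?_, ?_⟩
    · filter_upwards [hae] with x hx using hx.1 a
    · unfold algExperiment
      rw [← integral_finsetSum]
      · rw [integral_congr_ae (g := fun _ => (1 : ℝ))]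
        · simp
        · filter_upwards [hae] with x hx using hx.2
      · intro a _
        refine Integrable.of_mem_Icc 0 1 (measurable_signal i 0 a).aemeasurable ?_
        filter_upwards [hae] with x hx using ⟨hx.1 a, stdSimplex.le_one ⟨_, hx⟩ a⟩

theorem IsSymmetricLPSolver.integrable_expectedSignal_mul (i : Fin n) (k : Fin (N + 1))
    (a : Fin m) {h : Ω → ℝ} (hh : Measurable h) (h1 : ∀ ω, h ω ∈ Set.Icc (0 : ℝ) 1) :
    Integrable (fun z => expectedSignal κ i z k a * h (z k))
      (Measure.pi fun _ : Fin (N + 1) => μ) := by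
  refine integrable_of_mem_Icc
    ((measurable_expectedSignal κ i k a).mul (hh.comp (measurable_pi_apply k))) fun z => ?_
  have h2 := hκ.expectedSignal_mem_Icc i z k a
  exact ⟨mul_nonneg h2.1 (h1 _).1, mul_le_one₀ h2.2 (h1 _).1 (h1 _).2⟩

/-- By symmetry, the realized state is distributed like any other state of the list. -/
theorem IsSymmetricLPSolver.integral_algExperiment_mul (i : Fin n) (k : Fin (N + 1)) (a : Fin m)
    {h : Ω → ℝ} (hh : Measurable h) (h1 : ∀ ω, h ω ∈ Set.Icc (0 : ℝ) 1) :
    ∫ ω, algExperiment μ κ i ω a * h ω ∂μ =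
      ∫ z, expectedSignal κ i z k a * h (z k) ∂(Measure.pi fun _ : Fin (N + 1) => μ) := by
  have hint := fun k => hκ.integrable_expectedSignal_mul i k a hh h1
  have hmeas : ∀ k, AEStronglyMeasurable (fun z => expectedSignal κ i z k a * h (z k))
      (Measure.pi fun _ : Fin (N + 1) => μ) := fun k => (hint k).aestronglyMeasurable
  have hcons := measurePreserving_cons μ N
  -- Swapping entries `0` and `k` preserves the law of the list and, by symmetry of the solver,
  -- carries signal probabilities along with the states.
  have hperm := measurePreserving_comp_perm μ (Equiv.swap 0 k)
  trans ∫ z, expectedSignal κ i z 0 a * h (z 0) ∂(Measure.pi fun _ : Fin (N + 1) => μ)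
  · rw [← hcons.map_eq, integral_map hcons.measurable.aemeasurable
      (by rw [hcons.map_eq]; exact hmeas 0), integral_prod]
    · simp only [Fin.cons_zero, hκ.algExperiment_eq, integral_mul_const]
    · exact hcons.integrable_comp_of_integrable (hint 0)
  · conv_lhs => rw [← hperm.map_eq]
    rw [integral_map hperm.measurable.aemeasurable (by rw [hperm.map_eq]; exact hmeas 0)]
    simp only [hκ.expectedSignal_comp_perm, Function.comp, Equiv.swap_apply_left]

variable (hu : ∀ i a, Measurable fun ω => u i ω a) (hu1 : ∀ i ω a, u i ω a ∈ Set.Icc (0 : ℝ) 1)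

include hu hu1

/-- All `N + 1` terms of the empirical mean have the same expectation, namely the true payoff of the
executed experiment. -/
theorem IsSymmetricLPSolver.followValue_algExperiment (i j : Fin n) (σ : Fin m → Fin m) :
    Integrable (fun z => empFollowValue (u i ∘ z) (expectedSignal κ j z) σ)
      (Measure.pi fun _ : Fin (N + 1) => μ) ∧
    followValue μ (u i) (algExperiment μ κ j) σ =
      ∫ z, empFollowValue (u i ∘ z) (expectedSignal κ j z) σ
        ∂(Measure.pi fun _ : Fin (N + 1) => μ) := by
  have hint := fun a k => hκ.integrable_expectedSignal_mul (μ := μ) j k a (hu i (σ a))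
    (hu1 i · (σ a))
  unfold followValue empFollowValue
  simp only [Function.comp]
  refine ⟨integrable_finsetSum _ fun a _ => (integrable_finsetSum _ fun k _ =>
    hint a k).const_mul _, ?_⟩
  rw [integral_finsetSum _ fun a _ => (integrable_finsetSum _ fun k _ =>
    hint a k).const_mul _]
  refine Finset.sum_congr rfl fun a _ => ?_
  rw [integral_const_mul, integral_finsetSum _ fun k _ => hint a k]
  simp only [← hκ.integral_algExperiment_mul j _ a (hu i (σ a)) (hu1 i · (σ a)),
    Finset.sum_const, Finset.card_univ, Fintype.card_fin, nsmul_eq_mul]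
  rw [← mul_assoc, one_div_mul_cancel (by positivity), one_mul]

omit [IsProbabilityMeasure μ] hu hu1 in
theorem IsSymmetricLPSolver.empFollowValue_expectedSignal (i j : Fin n) (σ : Fin m → Fin m)
    (z : Fin (N + 1) → Ω) :
    Integrable (fun x => empFollowValue (u i ∘ z) (x.1 j) σ) (κ z) ∧
    empFollowValue (u i ∘ z) (expectedSignal κ j z) σ =
      ∫ x, empFollowValue (u i ∘ z) (x.1 j) σ ∂κ z := by
  have hint := fun a k => (hκ.integrable_signal j k a z).mul_const ((u i ∘ z) k (σ a))
  unfold empFollowValue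
  refine ⟨integrable_finsetSum _ fun a _ => (integrable_finsetSum _ fun k _ =>
    hint a k).const_mul _, ?_⟩
  rw [integral_finsetSum _ fun a _ => (integrable_finsetSum _ fun k _ =>
    hint a k).const_mul _]
  refine Finset.sum_congr rfl fun a _ => ?_
  rw [integral_const_mul, integral_finsetSum _ fun k _ => hint a k]
  simp only [integral_mul_const]
  rfl

variable (hm : 0 < m) (hf : f ∈ stdSimplex ℝ (Fin n))

include hm hf

omit [IsMarkovKernel κ] hu in
theorem IsSymmetricLPSolver.ae_price_mem_Icc (i : Fin n) (z : Fin (N + 1) → Ω) :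
    ∀ᵐ x ∂κ z, x.2 i ∈ Set.Icc (-2 : ℝ) 1 := by
  filter_upwards [hκ.optimal z] with x hx using hx.price_mem_Icc hm hu1 hf i

omit hu in
theorem IsSymmetricLPSolver.integrable_price (i : Fin n) :
    Integrable (fun x => x.2 i) (lpOutputLaw μ κ) := by
  rw [lpOutputLaw_eq]
  exact (integral_bind_of_mem_Icc (measurable_price i) (hκ.ae_price_mem_Icc hu1 hm hf i)).1

/-- The incentive constraints of the linear program hold in expectation over the list of states
and the solver. -/
theorem IsSymmetricLPSolver.isICDirectMenu :
    IsICDirectMenu μ u (algExperiment μ κ) (algExpectedPrice μ κ) := by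
  have hprice : ∀ i, algExpectedPrice μ κ i =
      ∫ z, ∫ x, x.2 i ∂κ z ∂(Measure.pi fun _ : Fin (N + 1) => μ) := fun i => by
    rw [algExpectedPrice, lpOutputLaw_eq]
    exact (integral_bind_of_mem_Icc (measurable_price i) (hκ.ae_price_mem_Icc hu1 hm hf i)).2
  have hpz : ∀ i z, Integrable (fun x => x.2 i) (κ z) := fun i z =>
    Integrable.of_mem_Icc (-2) 1 (measurable_price i).aemeasurable
      (hκ.ae_price_mem_Icc hu1 hm hf i z)
  have hpint : ∀ i, Integrable (fun z => ∫ x, x.2 i ∂κ z)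
      (Measure.pi fun _ : Fin (N + 1) => μ) := fun i =>
    Integrable.of_mem_Icc (-2) 1
      ((measurable_price i).stronglyMeasurable.integral_kernel (κ := κ)).measurable.aemeasurable
      (.of_forall fun z => integral_mem_Icc (measurable_price i)
        (hκ.ae_price_mem_Icc hu1 hm hf i z))
  have hob : ∀ i, obedientValue μ (u i) (algExperiment μ κ i) =
      followValue μ (u i) (algExperiment μ κ i) id := fun _ => rfl
  have hfol := fun i j σ => hκ.followValue_algExperiment hu hu1 i j σ
  have hemp := fun i j σ z => hκ.empFollowValue_expectedSignal i j σ z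
  refine ⟨hκ.isExperiment_algExperiment, fun i j => ?_, fun i => ?_⟩
  -- The best response `σ` is to the averaged experiment, so it does not depend on the list or on
  -- the solver's randomness, and the program's constraint for this `σ` can be integrated.
  · obtain ⟨σ, hσ⟩ := exists_followValue_eq_value hm μ (u i) (algExperiment μ κ j)
    rw [hob, ← hσ, (hfol i j σ).2, (hfol i i id).2, hprice, hprice,
      ← integral_sub (hfol i j σ).1 (hpint j), ← integral_sub (hfol i i id).1 (hpint i)]
    refine integral_mono ((hfol i j σ).1.sub (hpint j)) ((hfol i i id).1.sub (hpint i))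
      fun z => ?_
    dsimp only
    rw [(hemp i j σ z).2, (hemp i i id z).2, ← integral_sub (hemp i j σ z).1 (hpz j z),
      ← integral_sub (hemp i i id z).1 (hpz i z)]
    refine integral_mono_ae ((hemp i j σ z).1.sub (hpz j z)) ((hemp i i id z).1.sub (hpz i z)) ?_
    filter_upwards [hκ.optimal z] with x hx using ((isLPFeasible_iff hm).1 hx.1).2.2 i j σ
  · rw [hob, (hfol i i id).2, hprice, ← integral_sub (hfol i i id).1 (hpint i)]
    have hconst : baseline μ (u i) =
        ∫ _, baseline μ (u i) ∂(Measure.pi fun _ : Fin (N + 1) => μ) := by simp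
    rw [hconst]
    refine integral_mono (integrable_const _) ((hfol i i id).1.sub (hpint i)) fun z => ?_
    have hconst' : baseline μ (u i) = ∫ _, baseline μ (u i) ∂κ z := by simp
    dsimp only
    rw [(hemp i i id z).2, ← integral_sub (hemp i i id z).1 (hpz i z), hconst']
    refine integral_mono_ae (integrable_const _) ((hemp i i id z).1.sub (hpz i z)) ?_
    filter_upwards [hκ.optimal z] with x hx using ((isLPFeasible_iff hm).1 hx.1).2.1 i

omit hu hu1 hm hf in
/-- If the linear program has a feasible point of revenue at least `r` on all lists of states
in `B`, then the solver's revenue is at least `r` with at least the probability of `B`. -/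
theorem IsSymmetricLPSolver.le_measureReal_revenue {B : Set (Fin (N + 1) → Ω)} {r δ : ℝ}
    (hB : ∀ z ∈ B, ∃ y, IsLPFeasible μ u z y ∧ r ≤ ∑ i, f i * y.2 i)
    (hδ : (Measure.pi fun _ : Fin (N + 1) => μ).real Bᶜ ≤ δ) :
    1 - δ ≤ (lpOutputLaw μ κ).real {x | r ≤ ∑ i, f i * x.2 i} := by
  set P := Measure.pi fun _ : Fin (N + 1) => μ with hP
  have hA : MeasurableSet {x : LPPoint n m (N + 1) | r ≤ ∑ i, f i * x.2 i} :=
    measurableSet_le measurable_const (by fun_prop)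
  suffices h : (lpOutputLaw μ κ).real {x | r ≤ ∑ i, f i * x.2 i}ᶜ ≤ δ by
    rw [probReal_compl_eq_one_sub hA] at h
    linarith
  refine le_trans ?_ hδ
  rw [lpOutputLaw_eq, measureReal_def, measureReal_def]
  refine ENNReal.toReal_mono (measure_ne_top _ _) ?_
  rw [Measure.bind_apply hA.compl κ.aemeasurable]
  calc ∫⁻ z, κ z {x | r ≤ ∑ i, f i * x.2 i}ᶜ ∂P
      -- `B` need not be measurable, so its complement is replaced by a measurable hull of the same
      -- measure.
      ≤ ∫⁻ z, (toMeasurable P Bᶜ).indicator 1 z ∂P := by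
        refine lintegral_mono fun z => ?_
        by_cases hz : z ∈ toMeasurable P Bᶜ
        · simpa [hz] using prob_le_one
        · have hzB : z ∈ B := by
            by_contra h
            exact hz (subset_toMeasurable _ _ h)
          obtain ⟨y, hy, hr⟩ := hB z hzB
          have h0 : κ z {x | r ≤ ∑ i, f i * x.2 i}ᶜ = 0 := by
            change ∀ᵐ x ∂κ z, r ≤ ∑ i, f i * x.2 i
            filter_upwards [hκ.optimal z] with x hx using hr.trans (hx.2 y hy)
          simp [h0]
    _ = P Bᶜ := by
        rw [lintegral_indicator_one (measurableSet_toMeasurable _ _), measure_toMeasurable]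

end Incentives

/-! ### Choice of the constants -/

/-- With `p = m * n`, the number of events is at most `2 * p ^ (m + 2)`, and `2 ≤ p` absorbs the
factor 2, giving `p ^ (4 * m)`. For `p = 1` there are two events and the bound can fail as `δ` tends
to 1. -/
theorem union_bound_mul_exp_le {n m : ℕ} (hn : 0 < n) (hm : 0 < m) (hmn : 2 ≤ m * n) {δ x : ℝ}
    (hδ : 0 < δ) (hδ1 : δ < 1) (hx : 4 * (m * Real.log (m * n / δ)) ≤ x) :
    ((n : ℝ) ^ 2 * (m : ℝ) ^ m + n) * Real.exp (-x) ≤ δ := by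
  have hn1 : (1 : ℝ) ≤ n := by exact_mod_cast hn
  have hm1 : (1 : ℝ) ≤ m := by exact_mod_cast hm
  have hp2 : (2 : ℝ) ≤ m * n := by exact_mod_cast hmn
  set p : ℝ := m * n with hp
  have hp1 : 1 ≤ p := by linarith
  have hq : 0 < p / δ := by positivity
  have hnp : (n : ℝ) ≤ p := le_mul_of_one_le_left (by positivity) hm1
  have hmp : (m : ℝ) ≤ p := le_mul_of_one_le_right (by positivity) hn1
  have h1 : Real.exp (-x) ≤ ((p / δ) ^ (4 * m))⁻¹ := by
    rw [← Real.exp_log (pow_pos hq _), ← Real.exp_neg, Real.log_pow]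
    refine Real.exp_le_exp.2 (neg_le_neg ?_)
    push_cast
    linarith
  have h2 : (n : ℝ) ^ 2 * (m : ℝ) ^ m + n ≤ p ^ (4 * m) := by
    have h3 : (n : ℝ) ^ 2 * (m : ℝ) ^ m ≤ p ^ 2 * p ^ m := by gcongr
    have h4 : (n : ℝ) ≤ p ^ 2 * p ^ m := by
      rw [← pow_add]
      exact hnp.trans (le_self_pow₀ hp1 (by omega))
    calc (n : ℝ) ^ 2 * (m : ℝ) ^ m + n ≤ 2 * (p ^ 2 * p ^ m) := by linarith
      _ ≤ p * (p ^ 2 * p ^ m) := by gcongr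
      _ = p ^ (m + 3) := by ring
      _ ≤ p ^ (4 * m) := pow_le_pow_right₀ hp1 (by omega)
  have h3 : p ^ (4 * m) ≤ δ * (p / δ) ^ (4 * m) := by
    rw [div_pow, mul_div_assoc', le_div_iff₀ (by positivity), mul_comm]
    gcongr
    exact pow_le_of_le_one hδ.le hδ1.le (by omega)
  calc _ ≤ δ * (p / δ) ^ (4 * m) * ((p / δ) ^ (4 * m))⁻¹ :=
        mul_le_mul (h2.trans h3) h1 (Real.exp_pos _).le (by positivity)
    _ = δ := mul_inv_cancel_right₀ (by positivity) _

/-- The smaller term of the minimum selects the discount scheme: `e = ε / (8 * n)` for ranks, or `e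
= ε ^ 2 / 64` with `η = ε / 4` for proportional discounts. The repair may lose `3 * ε / 4`, since `ε
/ 4` is reserved for the near-optimal menu. -/
theorem exists_sampling_precision {n : ℕ} (hn : 0 < n) {ε : ℝ} (hε : 0 < ε) (hε1 : ε < 1) :
    ∃ e : ℝ, 0 < e ∧ e ≤ 3 * ε / 4 ∧
      1 / 4096 ≤ e ^ 2 * min ((n : ℝ) ^ 2 / ε ^ 2) (1 / ε ^ 4) ∧
      ((1 + 3 * n) * e ≤ 3 * ε / 4 ∨ ∃ η, 0 < η ∧ η + e + 3 * e / η ≤ 3 * ε / 4) := by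
  have hn1 : (1 : ℝ) ≤ n := by exact_mod_cast hn
  have hn0 : (n : ℝ) ≠ 0 := by positivity
  rcases le_total ((n : ℝ) ^ 2 / ε ^ 2) (1 / ε ^ 4) with h | h
  · have h1 : (1 + 3 * n) * (ε / (8 * n)) ≤ 3 * ε / 4 := by
      rw [mul_div_assoc', div_le_iff₀ (by positivity)]
      nlinarith
    have he : 0 < ε / (8 * n) := by positivity
    refine ⟨ε / (8 * n), he, ?_, ?_, .inl h1⟩
    · exact le_trans (le_mul_of_one_le_left he.le (by linarith)) h1
    · rw [min_eq_left h]
      have : (ε / (8 * n)) ^ 2 * ((n : ℝ) ^ 2 / ε ^ 2) = 1 / 64 := by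
        field_simp
        norm_num
      rw [this]
      norm_num
  · refine ⟨ε ^ 2 / 64, by positivity, by nlinarith, ?_, .inr ⟨ε / 4, by positivity, ?_⟩⟩
    · rw [min_eq_right h]
      have : (ε ^ 2 / 64) ^ 2 * (1 / ε ^ 4) = 1 / 4096 := by
        field_simp
        norm_num
      rw [this]
    · have : 3 * (ε ^ 2 / 64) / (ε / 4) = 3 * ε / 16 := by
        field_simp
        norm_num
      rw [this]
      nlinarith

/-! ### The revenue guarantee -/

section Revenue

variable {Ω : Type*} [MeasurableSpace Ω] {n m N : ℕ} {μ : Measure Ω} [IsProbabilityMeasure μ]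
  {f : Fin n → ℝ} {u : Fin n → Ω → Fin m → ℝ} {E : Fin n → Ω → Fin m → ℝ} {t : Fin n → ℝ}

omit [IsProbabilityMeasure μ] in
/-- With one type and one action, no incentive constraints are at stake. -/
theorem exists_isLPFeasible_of_subsingleton {K : ℕ} (hm : 0 < m) [Subsingleton (Fin n)]
    [Subsingleton (Fin m)] (hf : f ∈ stdSimplex ℝ (Fin n)) (hE : IsICDirectMenu μ u E t)
    {ω : Fin K → Ω} {e : ℝ}
    (hω : ∀ i, obedientValue μ (u i) (E i) ≤ empFollowValue (u i ∘ ω) (E i ∘ ω) id + e) :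
    ∃ y : LPPoint n m K, IsLPFeasible μ u ω y ∧ ∑ i, f i * t i - e ≤ ∑ i, f i * y.2 i := by
  refine ⟨(fun i => E i ∘ ω, fun i => t i - e), (isLPFeasible_iff hm).2
    ⟨fun i k => (hE.isExperiment i).mem_simplex (ω k), fun i => ?_, fun i j σ => ?_⟩, ?_⟩
  · dsimp only
    linarith [hE.ir i, hω i]
  · rw [Subsingleton.elim j i, Subsingleton.elim σ id]
  · simp only [mul_sub, Finset.sum_sub_distrib, ← Finset.sum_mul, hf.2, one_mul, le_refl]

theorem IsSymmetricLPSolver.revenue_guarantee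
    {κ : Kernel (Fin (N + 1) → Ω) (LPPoint n m (N + 1))} [IsMarkovKernel κ]
    (hκ : IsSymmetricLPSolver μ f u κ) (hn : 0 < n) (hm : 0 < m)
    (hf : f ∈ stdSimplex ℝ (Fin n)) (hu : ∀ i a, Measurable fun ω => u i ω a)
    (hu1 : ∀ i ω a, u i ω a ∈ Set.Icc (0 : ℝ) 1) {ε δ : ℝ} (hε : 0 < ε) (hε1 : ε < 1)
    (hδ : 0 < δ) (hδ1 : δ < 1)
    (hN : 8192 * (min ((n : ℝ) ^ 2 / ε ^ 2) (1 / ε ^ 4) *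
      ((m : ℝ) * Real.log ((m : ℝ) * (n : ℝ) / δ))) ≤ (N + 1 : ℕ)) :
    1 - δ ≤ (lpOutputLaw μ κ).real {x | optimalRevenue μ f u - ε ≤ ∑ i, f i * x.2 i} := by
  obtain ⟨e, he, heε, hemin, hL⟩ := exists_sampling_precision hn hε hε1
  obtain ⟨E, t, hE, hR⟩ := exists_isICDirectMenu_lt (μ := μ) hm hu hu1 f
    (sub_lt_self (optimalRevenue μ f u) (by positivity : 0 < ε / 4))
  have hn1 : (1 : ℝ) ≤ n := by exact_mod_cast hn
  have hm1 : (1 : ℝ) ≤ m := by exact_mod_cast hm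
  have hlog : 0 ≤ (m : ℝ) * Real.log ((m : ℝ) * (n : ℝ) / δ) := by
    refine mul_nonneg (by positivity) (Real.log_nonneg ?_)
    rw [le_div_iff₀ hδ]
    nlinarith
  -- The Hoeffding exponent is large enough because `2 * 8192 / 4096 = 4`.
  have hx : 4 * ((m : ℝ) * Real.log ((m : ℝ) * (n : ℝ) / δ)) ≤ 2 * (N + 1 : ℕ) * e ^ 2 := by
    have h1 := mul_le_mul_of_nonneg_left hN (sq_nonneg e)
    have h2 := mul_le_mul_of_nonneg_right hemin hlog
    linarith
  -- For `m = n = 1` only the lower-tail event matters, so its single Hoeffding bound replaces the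
  -- union bound.
  rcases lt_or_ge (m * n) 2 with hmn | hmn
  · have hprod : m * n = 1 := by
      have := Nat.mul_pos hm hn
      omega
    obtain ⟨rfl, rfl⟩ := mul_eq_one.1 hprod
    refine hκ.le_measureReal_revenue (B := {ω | empFollowValue (u 0 ∘ ω) (E 0 ∘ ω) id + e <
      obedientValue μ (u 0) (E 0)}ᶜ) (fun z hz => ?_) ?_
    · obtain ⟨y, hy, hyR⟩ := exists_isLPFeasible_of_subsingleton (e := e) hm hf hE (ω := z)
        fun i => by
          rw [Subsingleton.elim i 0]
          exact not_lt.1 hz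
      exact ⟨y, hy, by linarith⟩
    · rw [compl_compl]
      refine (measureReal_obedient_lower hu hu1 hE.isExperiment N.succ_pos he.le 0).trans ?_
      rw [← Real.le_log_iff_exp_le hδ]
      simp only [Nat.cast_one, one_mul, one_div, Real.log_inv] at hx
      have := Real.log_neg hδ hδ1
      push_cast at hx ⊢
      linarith
  · refine hκ.le_measureReal_revenue (B := representativeSamples (N + 1) μ u E e)
      (fun z hz => ?_) ((measureReal_representativeSamples_compl_le hu hu1 hE.isExperiment
        N.succ_pos he.le).trans ?_)
    · rcases hL with hL | ⟨η, hη, hL⟩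
      · obtain ⟨y, hy, hyR⟩ := exists_isLPFeasible_of_rank_discount hm hf he hE hz
        exact ⟨y, hy, by linarith⟩
      · obtain ⟨y, hy, hyR⟩ :=
          exists_isLPFeasible_of_proportional_discount hm hf hu hu1 he hη hE hz
        exact ⟨y, hy, by linarith⟩
    · have := union_bound_mul_exp_le hn hm hmn hδ hδ1 hx
      rwa [← neg_mul, ← neg_mul] at this

end Revenue

end

end DataPricing

theorem theorem1 :
    ∃ C : ℝ, 0 < C ∧
      ∀ (n m : ℕ) (ε δ : ℝ), 0 < n → 0 < m → 0 < ε → ε < 1 → 0 < δ → δ < 1 →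
        ∃ N : ℕ,
          N + 1 ≤ ⌈C * (min ((n : ℝ) ^ 2 / ε ^ 2) (1 / ε ^ 4) *
            ((m : ℝ) * Real.log ((m : ℝ) * (n : ℝ) / δ)))⌉₊ ∧
          ∀ (Ω : Type*) [MeasurableSpace Ω] (μ : MeasureTheory.Measure Ω)
            [MeasureTheory.IsProbabilityMeasure μ]
            (f : Fin n → ℝ) (u : Fin n → Ω → Fin m → ℝ),
            f ∈ stdSimplex ℝ (Fin n) →
            (∀ i a, Measurable fun ω => u i ω a) →
            (∀ i ω a, u i ω a ∈ Set.Icc (0 : ℝ) 1) →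
            ∀ (κ : ProbabilityTheory.Kernel (Fin (N + 1) → Ω)
                (DataPricing.LPPoint n m (N + 1)))
              [ProbabilityTheory.IsMarkovKernel κ],
              DataPricing.IsSymmetricLPSolver μ f u κ →
              DataPricing.IsICDirectMenu μ u (DataPricing.algExperiment μ κ)
                (DataPricing.algExpectedPrice μ κ) ∧
              (∀ i, MeasureTheory.Integrable (fun x => x.2 i)
                (DataPricing.lpOutputLaw μ κ)) ∧
              1 - δ ≤ (DataPricing.lpOutputLaw μ κ).real
                {x | DataPricing.optimalRevenue μ f u - ε ≤ ∑ i, f i * x.2 i} := by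
  refine ⟨8192, by norm_num, fun n m ε δ hn hm hε hε1 hδ hδ1 => ?_⟩
  have hX : 0 < 8192 * (min ((n : ℝ) ^ 2 / ε ^ 2) (1 / ε ^ 4) *
      ((m : ℝ) * Real.log ((m : ℝ) * (n : ℝ) / δ))) := by
    have hn1 : (1 : ℝ) ≤ n := by exact_mod_cast hn
    have hm1 : (1 : ℝ) ≤ m := by exact_mod_cast hm
    have hlog : 0 < Real.log ((m : ℝ) * (n : ℝ) / δ) := by
      refine Real.log_pos ?_
      rw [lt_div_iff₀ hδ]
      nlinarith
    positivity
  have hceil := Nat.ceil_pos.2 hX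
  -- `K = N + 1` is the ceiling itself. It is positive because `δ < 1` makes the logarithm positive,
  -- so the truncated subtraction is exact.
  refine ⟨⌈8192 * (min ((n : ℝ) ^ 2 / ε ^ 2) (1 / ε ^ 4) *
      ((m : ℝ) * Real.log ((m : ℝ) * (n : ℝ) / δ)))⌉₊ - 1, by omega, ?_⟩
  intro Ω _ μ _ f u hf hu hu1 κ _ hκ
  refine ⟨hκ.isICDirectMenu hu hu1 hm hf, fun i => hκ.integrable_price hu1 hm hf i,
    hκ.revenue_guarantee hn hm hf hu hu1 hε hε1 hδ hδ1 ?_⟩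
  rw [Nat.sub_add_cancel hceil]
  exact Nat.le_ceil _
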